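/- Let $X$ be an at most countable set and let $\mu$ be a measure on $2^X$ with $\mu(x):=\mu(\{x\})\in(0,\infty)$ for every $x\in X$. Let $T\colon X\to X$ be a map, and let $h_T$ denote the Radon--Nikodym derivative of $\mu\circ T^{-1}$ with respect to $\mu$, that is, $h_T(x)=\mu(T^{-1}(\{x\}))/\mu(x)$. Assume $h_T\in L^\infty(\mu)$. Put $\lambda_v=\sqrt{\mu(v)}/\sqrt{\mu(Tv)}$ for $v\in X$, and let $S_{\boldsymbol\lambda}$ be the bounded operator on the complex Hilbert space $\ell^2(X)$ with $$S_{\boldsymbol\lambda}e_u=\sum_{v\in X,\;Tv=u}\lambda_v e_v,\qquad u\in X,$$ where $(e_u)_{u\in X}$ is the standard orthonormal basis (this operator is unitarily equivalent to the composition operator $f\mapsto f\circ T$ on $L^2(\mu)$). Let $G_T$ be the directed graph with vertex set $X$ and edge set $E_T=\{(Tx,x):x\in X\}$. A directed tree is a connected directed graph without cycles in which every vertex has in-degree at most $1$; a root of it is a vertex of in-degree $0$. **Theorem.** Suppose that $G_T$ is connected (when the orientation of its edges is disregarded) and that it has one cycle, in the following sense: (a) there are $\kappa\ge 1$ and distinct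 vertices $v_0,\dots,v_{\kappa-1}\in X$ such that $(v_j,v_{j+1})\in E_T$ for $0\le j\le\kappa-2$ and $(v_{\kappa-1},v_0)\in E_T$; (b) there is a (possibly empty) partition $\mathcal R$ of $X\setminus\{v_0,\dots,v_{\kappa-1}\}$ such that for every $R\in\mathcal R$ the subgraph of $G_T$ induced on $R$ is a directed tree with a root $\omega_R$, and there is exactly one $i\in\{0,\dots,\kappa-1\}$ with $(v_i,\omega_R)\in E_T$. Then the following conditions are equivalent: (i) $S_{\boldsymbol\lambda}$ is $2$-isometric, that is, $I-2S_{\boldsymbol\lambda}^*S_{\boldsymbol\lambda}+S_{\boldsymbol\lambda}^{*2}S_{\boldsymbol\lambda}^2=0$; (ii) $S_{\boldsymbol\lambda}$ is completely hyperexpansive, that is, $\sum_{k=0}^{n}(-1)^k\binom nk S_{\boldsymbol\lambda}^{*k}S_{\boldsymbol\lambda}^k\le 0$ for every integer $n\ge1$. -/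

import Mathlib

open MeasureTheory
open scoped ENNReal lp

/-! ### Discrete measure spaces and the Radon–Nikodym derivative of a self-map -/

/-- Every point has positive and finite mass. -/
structure IsDiscreteMeasure {X : Type*} [MeasurableSpace X] (μ : Measure X) : Prop where
  pos : ∀ x, 0 < μ {x}
  lt_top : ∀ x, μ {x} < ∞

/-- The Radon–Nikodym derivative `h_T` of `μ ∘ T⁻¹` with respect to `μ`. -/
noncomputable def selfMapDeriv {X : Type*} [MeasurableSpace X] (μ : Measure X) (T : X → X) :
    X → ℝ≥0∞ :=
  (μ.map T).rnDeriv μ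

/-! ### Directed graphs -/

section Graphs

variable {V : Type*}

/-- The graph `G_T` of a self-map: its edges are the pairs `(T x, x)`. -/
def selfMapGraph (T : V → V) : Digraph V where
  Adj u v := T v = u

/-- Connectedness of a directed graph, the orientation of the edges being forgotten. -/
def Digraph.IsConnected (G : Digraph V) : Prop :=
  G.toSimpleGraphInclusive.Connected

/-- The in-degree of a vertex. -/
noncomputable def Digraph.inDeg (G : Digraph V) (v : V) : ℕ∞ :=
  {w | G.Adj w v}.encard

/-- `G` has no cycle, that is, no directed path of positive length from a vertex to itself. -/
def Digraph.HasNoCycle (G : Digraph V) : Prop :=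
  ∀ v, ¬ Relation.TransGen G.Adj v v

/-- A directed tree is a connected directed graph without cycles all of whose vertices have
in-degree at most one. -/
def Digraph.IsDirectedTree (G : Digraph V) : Prop :=
  G.IsConnected ∧ G.HasNoCycle ∧ ∀ v, G.inDeg v ≤ 1

/-- A directed tree with root `ω`. -/
def Digraph.IsDirectedTreeWithRoot (G : Digraph V) (ω : V) : Prop :=
  G.IsDirectedTree ∧ G.inDeg ω = 0

/-- The subgraph induced on a set of vertices. -/
def Digraph.inducedOn (G : Digraph V) (R : Set V) : Digraph R where
  Adj u w := G.Adj u w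

/-- The graph consists of one cycle `v₀ → v₁ → ⋯ → v_{κ-1} → v₀` with `κ ≥ 1` distinct vertices and
of rooted directed trees, partitioning the remaining vertices, such that there is an edge to the
root of each tree from exactly one vertex of the cycle. -/
def Digraph.IsCycleWithTrees (G : Digraph V) : Prop :=
  ∃ κ : ℕ, 1 ≤ κ ∧ ∃ v : Fin κ → V, Function.Injective v ∧
    (∀ i j : Fin κ, (j : ℕ) = ((i : ℕ) + 1) % κ → G.Adj (v i) (v j)) ∧
    ∃ 𝓡 : Partition (Set.range v)ᶜ, ∀ R ∈ 𝓡, ∃ ω : R,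
      (G.inducedOn R).IsDirectedTreeWithRoot ω ∧ ∃! i : Fin κ, G.Adj (v i) ω

end Graphs

/-! ### Classes of operators -/

section Operators

variable {H : Type*} [NormedAddCommGroup H] [InnerProductSpace ℂ H] [CompleteSpace H]

/-- `m`-isometric operators (`m ≥ 1`): `∑_{k=0}^m (-1)^(m-k) (m choose k) S^{*k} S^k = 0`. -/
def IsMIsometric (m : ℕ) (S : H →L[ℂ] H) : Prop :=
  ∑ k ∈ Finset.range (m + 1),
    ((-1 : ℂ) ^ (m - k) * (m.choose k : ℂ)) • (ContinuousLinearMap.adjoint S ^ k * S ^ k) = 0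

/-- Completely hyperexpansive operators: `∑_{k=0}^n (-1)^k (n choose k) S^{*k} S^k ≤ 0` for every
`n ≥ 1`, where `≤` is the usual order between self-adjoint operators. -/
def IsCompletelyHyperexpansive (S : H →L[ℂ] H) : Prop :=
  ∀ n : ℕ, 1 ≤ n →
    ∑ k ∈ Finset.range (n + 1),
      ((-1 : ℂ) ^ k * (n.choose k : ℂ)) • (ContinuousLinearMap.adjoint S ^ k * S ^ k) ≤ 0

end Operators

/-! ### Auxiliary facts on `ℓ²` -/

lemma memlp_two_of_tsum_lt_top {X : Type*} {f : X → ℂ} (hf : ∑' v, ‖f v‖ₑ ^ 2 < ∞) : Memℓp f 2 := by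
  refine memℓp_gen ?_
  have h : ∀ v, ‖f v‖ₑ ^ 2 = ((‖f v‖₊ ^ 2 : NNReal) : ℝ≥0∞) := fun v => by simp [enorm]
  simp_rw [h] at hf
  have h2 := NNReal.summable_coe.2 (ENNReal.tsum_coe_ne_top_iff_summable.1 hf.ne)
  simpa using h2

lemma tsum_enorm_sq {X : Type*} (f : ℓ²(X, ℂ)) : ∑' v, ‖f v‖ₑ ^ 2 = ‖f‖ₑ ^ 2 := by
  have h := lp.hasSum_norm (p := 2) (by simp) f
  have h2 : HasSum (fun v => ‖f v‖ ^ 2) (‖f‖ ^ 2) := by simpa using h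
  have h3 : HasSum (fun v => ‖f v‖₊ ^ 2) (‖f‖₊ ^ 2) := NNReal.hasSum_coe.1 (by simpa using h2)
  have h4 := (ENNReal.hasSum_coe.2 h3).tsum_eq
  simpa [enorm] using h4

lemma norm_le_of_enorm_sq_le {X : Type*} {f g : ℓ²(X, ℂ)} {K : ℝ≥0∞} (hK : K ≠ ∞)
    (h : ‖g‖ₑ ^ 2 ≤ K * ‖f‖ₑ ^ 2) : ‖g‖ ≤ Real.sqrt K.toReal * ‖f‖ := by
  have h2 := ENNReal.toReal_mono
    (ENNReal.mul_ne_top hK (ENNReal.pow_ne_top enorm_ne_top)) h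
  rw [ENNReal.toReal_mul, ENNReal.toReal_pow, ENNReal.toReal_pow, toReal_enorm, toReal_enorm] at h2
  refine abs_le_of_sq_le_sq' ?_ (by positivity) |>.2
  rwa [mul_pow, Real.sq_sqrt ENNReal.toReal_nonneg]

/-! ### The weighted shift of a self-map -/

section WeightedShift

variable {X : Type*} [MeasurableSpace X]

/-- The weights `λ_v = √μ(v) / √μ(T v)`. -/
noncomputable def shiftWeight (μ : Measure X) (T : X → X) (v : X) : ℝ :=
  Real.sqrt (μ {v}).toReal / Real.sqrt (μ {T v}).toReal

lemma shiftWeight_enorm_sq {μ : Measure X} (hμ : IsDiscreteMeasure μ) (T : X → X) (v : X) :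
    ‖(shiftWeight μ T v : ℂ)‖ₑ ^ 2 = μ {v} / μ {T v} := by
  have h0 : 0 ≤ shiftWeight μ T v := by unfold shiftWeight; positivity
  have h1 : ‖(shiftWeight μ T v : ℂ)‖ₑ = ENNReal.ofReal (shiftWeight μ T v) := by
    rw [← ofReal_norm, Complex.norm_real, Real.norm_of_nonneg h0]
  have h2 : 0 < (μ {T v}).toReal := ENNReal.toReal_pos (hμ.pos _).ne' (hμ.lt_top _).ne
  rw [h1, ← ENNReal.ofReal_pow h0, shiftWeight, div_pow, Real.sq_sqrt ENNReal.toReal_nonneg,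
    Real.sq_sqrt ENNReal.toReal_nonneg, ENNReal.ofReal_div_of_pos h2,
    ENNReal.ofReal_toReal (hμ.lt_top _).ne, ENNReal.ofReal_toReal (hμ.lt_top _).ne]

lemma selfMapDeriv_le {μ : Measure X} (hμ : IsDiscreteMeasure μ) (T : X → X) (x : X) :
    selfMapDeriv μ T x ≤ eLpNorm (selfMapDeriv μ T) ∞ μ := by
  rw [eLpNorm_exponent_top]
  have h := enorm_ae_le_eLpNormEssSup (selfMapDeriv μ T) μ
  rw [ae_iff] at h
  by_contra hx
  refine (hμ.pos x).ne' (measure_mono_null ?_ h)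
  simpa using hx

variable [DiscreteMeasurableSpace X] [Countable X]

lemma selfMapDeriv_mul {μ : Measure X} (hμ : IsDiscreteMeasure μ) (T : X → X) (x : X) :
    selfMapDeriv μ T x * μ {x} = μ (T ⁻¹' {x}) := by
  have : SigmaFinite μ :=
    Measure.sigmaFinite_of_countable (S := Set.range fun y : X => ({y} : Set X))
      (Set.countable_range _) (by rintro _ ⟨y, rfl⟩; exact hμ.lt_top y)
      (by ext y; simp)
  have hac : μ.map T ≪ μ := by
    refine Measure.AbsolutelyContinuous.mk fun s _ hs => ?_
    have : s = ∅ := by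
      by_contra hne
      obtain ⟨y, hy⟩ := Set.nonempty_iff_ne_empty.2 hne
      exact (hμ.pos y).ne' (measure_mono_null (Set.singleton_subset_iff.2 hy) hs)
    simp [this]
  have h := Measure.withDensity_rnDeriv_eq (μ.map T) μ hac
  have h2 : (μ.withDensity ((μ.map T).rnDeriv μ)) {x} = μ.map T {x} := by rw [h]
  rw [withDensity_apply _ (measurableSet_singleton x), lintegral_singleton,
    Measure.map_apply Measurable.of_discrete (measurableSet_singleton x)] at h2
  exact h2

lemma tsum_enorm_shift_le {μ : Measure X} (hμ : IsDiscreteMeasure μ) (T : X → X) (f : X → ℂ) :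
    ∑' v, ‖(shiftWeight μ T v : ℂ) * f (T v)‖ₑ ^ 2 ≤
      eLpNorm (selfMapDeriv μ T) ∞ μ * ∑' u, ‖f u‖ₑ ^ 2 := by
  have h1 : ∑' v, ‖(shiftWeight μ T v : ℂ) * f (T v)‖ₑ ^ 2 =
      ∫⁻ v, ‖f (T v)‖ₑ ^ 2 / μ {T v} ∂μ := by
    rw [lintegral_countable']
    refine tsum_congr fun v => ?_
    rw [enorm_mul, mul_pow, shiftWeight_enorm_sq hμ, div_eq_mul_inv, div_eq_mul_inv]
    ring
  have h2 : ∫⁻ v, ‖f (T v)‖ₑ ^ 2 / μ {T v} ∂μ = ∫⁻ u, ‖f u‖ₑ ^ 2 / μ {u} ∂(μ.map T) :=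
    (lintegral_map (μ := μ) (f := fun u => ‖f u‖ₑ ^ 2 / μ {u}) (g := T)
      Measurable.of_discrete Measurable.of_discrete).symm
  rw [h1, h2, lintegral_countable', ← ENNReal.tsum_mul_left]
  refine ENNReal.tsum_le_tsum fun u => ?_
  rw [Measure.map_apply Measurable.of_discrete (measurableSet_singleton u),
    ← selfMapDeriv_mul hμ T u, mul_comm (selfMapDeriv μ T u), ← mul_assoc,
    ENNReal.div_mul_cancel (hμ.pos u).ne' (hμ.lt_top u).ne, mul_comm]
  gcongr
  exact selfMapDeriv_le hμ T u

/-- The weighted shift `S_λ` on `ℓ²(X)`, `(S_λ f)(v) = λ_v f(T v)`; it is the bounded operator with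
`S_λ e_u = ∑_{T v = u} λ_v e_v`, see `hasSum_weightedShift_single`. -/
noncomputable def weightedShift (μ : Measure X) (hμ : IsDiscreteMeasure μ) (T : X → X)
    (hT : MemLp (selfMapDeriv μ T) ∞ μ) : ℓ²(X, ℂ) →L[ℂ] ℓ²(X, ℂ) :=
  LinearMap.mkContinuous
    { toFun := fun f =>
        ⟨fun v => (shiftWeight μ T v : ℂ) * f (T v), memlp_two_of_tsum_lt_top <|
          (tsum_enorm_shift_le hμ T f).trans_lt <| by
            rw [tsum_enorm_sq]
            exact ENNReal.mul_lt_top hT.2 (ENNReal.pow_lt_top enorm_lt_top)⟩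
      map_add' := fun f g => Subtype.ext <| funext fun v => mul_add _ (f (T v)) (g (T v))
      map_smul' := fun c f => Subtype.ext <| funext fun v => mul_left_comm _ c (f (T v)) }
    (Real.sqrt (eLpNorm (selfMapDeriv μ T) ∞ μ).toReal) <| fun f => by
      refine norm_le_of_enorm_sq_le hT.2.ne ?_
      rw [← tsum_enorm_sq, ← tsum_enorm_sq f]
      exact tsum_enorm_shift_le hμ T f

@[simp]
lemma weightedShift_apply (μ : Measure X) (hμ : IsDiscreteMeasure μ) (T : X → X)
    (hT : MemLp (selfMapDeriv μ T) ∞ μ) (f : ℓ²(X, ℂ)) (v : X) :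
    weightedShift μ hμ T hT f v = (shiftWeight μ T v : ℂ) * f (T v) :=
  rfl

open Classical in
lemma hasSum_weightedShift_single (μ : Measure X) (hμ : IsDiscreteMeasure μ) (T : X → X)
    (hT : MemLp (selfMapDeriv μ T) ∞ μ) (u : X) :
    HasSum (fun v : {v : X // T v = u} => (shiftWeight μ T v : ℂ) • lp.single 2 (v : X) (1 : ℂ))
      (weightedShift μ hμ T hT (lp.single 2 u 1)) := by
  have h := lp.hasSum_single (p := 2) (by simp) (weightedShift μ hμ T hT (lp.single 2 u 1))
  have h0 : ∀ v : X, T v ≠ u →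
      lp.single (E := fun _ : X => ℂ) 2 v (weightedShift μ hμ T hT (lp.single 2 u 1) v) = 0 := by
    intro v hv
    rw [weightedShift_apply, lp.single_apply_ne _ _ _ hv, mul_zero]
    exact (lp.singleAddMonoidHom (E := fun _ : X => ℂ) 2 v).map_zero
  have h1 := (hasSum_subtype_iff_of_support_subset (s := {v : X | T v = u}) (fun v hv => by
    by_contra hne
    exact hv (h0 v hne))).2 h
  convert! h1 using 1
  funext v
  obtain ⟨v, hv⟩ := v
  subst hv
  refine lp.ext (funext fun w => ?_)
  change (shiftWeight μ T v : ℂ) * lp.single (E := fun _ : X => ℂ) 2 v 1 w =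
    lp.single (E := fun _ : X => ℂ) 2 v
      ((shiftWeight μ T v : ℂ) * lp.single (E := fun _ : X => ℂ) 2 (T v) 1 (T v)) w
  simp [lp.single_apply, Pi.single_apply]

end WeightedShift

/-! ### Defect operators and their quadratic forms. -/

section DefectForm

variable {H : Type*} [NormedAddCommGroup H] [InnerProductSpace ℂ H]

/-! Write `β n f` for `defectForm S n f`; then `β (n+1) f = β n f - β n (S f)`. If `β 2` vanishes,
`β 1` is constant along orbits and `‖S^k f‖²` is affine in `k`; being nonnegative it has slope `-β 1
f ≥ 0`, and all higher forms vanish. Conversely, `β 3 ≤ 0` makes `β 2` nondecreasing along orbits.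
For `x` on the cycle, of period `κ`, `S^κ e_x = e_x + g` with `g` supported off `x`; powers of `S`
keep supports disjoint, so `β 2` is additive here, and `β 2 ≤ 0` on the part coming from `g` forces
`β 2` to be constant along the orbit of `e_x`. A negative constant would eventually make `β 1`
positive, so it is `0`. Every `y` satisfies `T^m y = x` for some `m`, so `e_y` occurs in `S^m e_x`
with nonzero coefficient; two nonpositive terms sum to `0`, whence `β 2 e_y = 0`. The defect
operator is diagonal, so it vanishes. -/

/-- The quadratic form `f ↦ ∑_{k=0}^n (-1)^k (n choose k) ‖S^k f‖²`. -/
noncomputable def defectForm (S : H →L[ℂ] H) (n : ℕ) (f : H) : ℝ :=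
  ∑ k ∈ Finset.range (n + 1), (-1 : ℝ) ^ k * (n.choose k : ℝ) * ‖(S ^ k) f‖ ^ 2

/-- Pascal's rule. -/
lemma sum_alternating_choose_succ (p : ℕ → ℝ) (n : ℕ) :
    ∑ k ∈ Finset.range (n + 2), (-1 : ℝ) ^ k * ((n + 1).choose k : ℝ) * p k =
      ∑ k ∈ Finset.range (n + 1), (-1 : ℝ) ^ k * (n.choose k : ℝ) * p k -
        ∑ k ∈ Finset.range (n + 1), (-1 : ℝ) ^ k * (n.choose k : ℝ) * p (k + 1) := by
  -- The extra term `k = n + 1` is zero because `n.choose (n + 1) = 0`.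
  have h : ∑ k ∈ Finset.range (n + 1), (-1 : ℝ) ^ k * (n.choose k : ℝ) * p k =
      ∑ k ∈ Finset.range (n + 2), (-1 : ℝ) ^ k * (n.choose k : ℝ) * p k := by
    rw [Finset.sum_range_succ _ (n + 1)]
    simp
  rw [h, Finset.sum_range_succ', Finset.sum_range_succ' _ (n + 1), add_sub_right_comm,
    ← Finset.sum_sub_distrib]
  congr 1
  · refine Finset.sum_congr rfl fun k _ => ?_
    rw [Nat.choose_succ_succ]
    push_cast
    ring
  · simp

lemma defectForm_succ (S : H →L[ℂ] H) (n : ℕ) (f : H) :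
    defectForm S (n + 1) f = defectForm S n f - defectForm S n (S f) := by
  simp_rw [defectForm, ← mul_apply_eq_comp, ← pow_succ]
  exact sum_alternating_choose_succ (fun k => ‖(S ^ k) f‖ ^ 2) n

/-- Each application of `S` lowers the form of order `n` by the same amount `c`. -/
lemma defectForm_pow_apply {S : H →L[ℂ] H} {n : ℕ} {f : H} {c : ℝ}
    (h : ∀ k, defectForm S (n + 1) ((S ^ k) f) = c) (k : ℕ) :
    defectForm S n ((S ^ k) f) = defectForm S n f - k * c := by
  induction k with
  | zero => simp
  | succ k ih =>
    have h1 := defectForm_succ S n ((S ^ k) f)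
    rw [h, ih, ← mul_apply_eq_comp, ← pow_succ'] at h1
    rw [Nat.cast_succ]
    linarith

lemma defectForm_smul (S : H →L[ℂ] H) (c : ℂ) (f : H) (n : ℕ) :
    defectForm S n (c • f) =
      ‖c‖ ^ 2 * defectForm S n f := by
  rw [defectForm, defectForm, Finset.mul_sum]
  exact Finset.sum_congr rfl fun k _ => by rw [map_smul, norm_smul]; ring

variable [CompleteSpace H]

/-- The operator `∑_{k=0}^n (-1)^k (n choose k) S^{*k} S^k`. -/
noncomputable def defectOp (S : H →L[ℂ] H) (n : ℕ) : H →L[ℂ] H :=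
  ∑ k ∈ Finset.range (n + 1),
    ((-1 : ℂ) ^ k * (n.choose k : ℂ)) • (ContinuousLinearMap.adjoint S ^ k * S ^ k)

lemma inner_adjoint_pow_mul_pow (S : H →L[ℂ] H) (k : ℕ) (f g : H) :
    inner ℂ f ((ContinuousLinearMap.adjoint S ^ k * S ^ k) g) =
      inner ℂ ((S ^ k) f) ((S ^ k) g) := by
  have h : ContinuousLinearMap.adjoint S ^ k = ContinuousLinearMap.adjoint (S ^ k) :=
    (star_pow S k).symm
  rw [h, mul_apply_eq_comp, ContinuousLinearMap.adjoint_inner_right]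

lemma inner_defectOp (S : H →L[ℂ] H) (n : ℕ) (f g : H) :
    inner ℂ f (defectOp S n g) = ∑ k ∈ Finset.range (n + 1),
      ((-1 : ℂ) ^ k * (n.choose k : ℂ)) * inner ℂ ((S ^ k) f) ((S ^ k) g) := by
  simp_rw [defectOp, sum_apply, inner_sum, smul_apply,
    inner_smul_right, inner_adjoint_pow_mul_pow]

lemma inner_defectOp_self (S : H →L[ℂ] H) (n : ℕ) (f : H) :
    inner ℂ f (defectOp S n f) = defectForm S n f := by
  rw [inner_defectOp, defectForm]
  push_cast
  exact Finset.sum_congr rfl fun k _ => by rw [inner_self_eq_norm_sq_to_K]; rfl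

lemma isMIsometric_two_iff (S : H →L[ℂ] H) : IsMIsometric 2 S ↔ defectOp S 2 = 0 := by
  simp [IsMIsometric, defectOp, Finset.sum_range_succ]

lemma defectOp_nonpos_iff (S : H →L[ℂ] H) (n : ℕ) :
    defectOp S n ≤ 0 ↔ ∀ f, defectForm S n f ≤ 0 := by
  rw [ContinuousLinearMap.le_def, zero_sub, ContinuousLinearMap.isPositive_iff_complex]
  refine forall_congr' fun f => ?_
  have h : inner ℂ ((-defectOp S n) f) f = ((-defectForm S n f : ℝ) : ℂ) := by
    rw [← inner_conj_symm, neg_apply, inner_neg_right, inner_defectOp_self]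
    simp
  rw [h]
  simp

lemma isCompletelyHyperexpansive_iff (S : H →L[ℂ] H) :
    IsCompletelyHyperexpansive S ↔ ∀ n : ℕ, 1 ≤ n → ∀ f, defectForm S n f ≤ 0 :=
  forall₂_congr fun n _ => defectOp_nonpos_iff S n

lemma IsMIsometric.isCompletelyHyperexpansive {S : H →L[ℂ] H} (hS : IsMIsometric 2 S) :
    IsCompletelyHyperexpansive S := by
  rw [isMIsometric_two_iff] at hS
  rw [isCompletelyHyperexpansive_iff]
  have h2 : ∀ f, defectForm S 2 f = 0 := fun f => by
    have h := inner_defectOp_self S 2 f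
    rw [hS] at h
    simpa using h.symm
  have h1 : ∀ f, defectForm S 1 f ≤ 0 := fun f => by
    by_contra! hf
    have hc : ∀ k, defectForm S 1 ((S ^ k) f) = defectForm S 1 f := fun k => by
      simpa using defectForm_pow_apply (n := 1) (fun k => h2 ((S ^ k) f)) k
    -- For such `k`, the affine formula would make `‖S^k f‖²` negative.
    obtain ⟨k, hk⟩ := exists_nat_gt (defectForm S 0 f / defectForm S 1 f)
    rw [div_lt_iff₀ hf] at hk
    have h := defectForm_pow_apply hc k
    have h0 : 0 ≤ defectForm S 0 ((S ^ k) f) := by simp [defectForm]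
    linarith
  intro n hn
  induction n, hn using Nat.le_induction with
  | base => exact h1
  | succ n hn _ =>
    have h3 : ∀ n, ∀ f, defectForm S (n + 2) f = 0 := fun n => by
      induction n with
      | zero => exact h2
      | succ n ih => intro f; rw [defectForm_succ, ih, ih, sub_zero]
    obtain ⟨m, rfl⟩ := Nat.exists_eq_add_of_le hn
    intro f
    rw [show 1 + m + 1 = m + 2 by ring, h3]

lemma IsCompletelyHyperexpansive.defectForm_nonpos {S : H →L[ℂ] H}
    (hS : IsCompletelyHyperexpansive S) {n : ℕ} (hn : 1 ≤ n) (f : H) : defectForm S n f ≤ 0 :=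
  (isCompletelyHyperexpansive_iff S).1 hS n hn f

lemma IsCompletelyHyperexpansive.monotone_defectForm_two {S : H →L[ℂ] H}
    (hS : IsCompletelyHyperexpansive S) (f : H) :
    Monotone fun k => defectForm S 2 ((S ^ k) f) := by
  refine monotone_nat_of_le_succ fun k => ?_
  have h := hS.defectForm_nonpos (n := 3) (by norm_num) ((S ^ k) f)
  rw [defectForm_succ, ← mul_apply_eq_comp, ← pow_succ'] at h
  linarith

/-- If the second differences of `k ↦ ‖S^k f‖²` are periodically nonincreasing, they vanish. -/
lemma IsCompletelyHyperexpansive.defectForm_two_eq_zero {S : H →L[ℂ] H}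
    (hS : IsCompletelyHyperexpansive S) {f : H} {κ : ℕ} (hκ : 1 ≤ κ)
    (h : ∀ k, defectForm S 2 ((S ^ (k + κ)) f) ≤ defectForm S 2 ((S ^ k) f)) (k : ℕ) :
    defectForm S 2 ((S ^ k) f) = 0 := by
  have hm := hS.monotone_defectForm_two f
  have hc : ∀ k, defectForm S 2 ((S ^ k) f) = defectForm S 2 f := fun k => by
    induction k with
    | zero => simp
    | succ k ih =>
      rw [← ih]
      -- The value at `k + 1` is squeezed between those at `k` and `k + κ`, since `κ ≥ 1`.
      exact le_antisymm ((hm (Nat.add_le_add_left hκ k)).trans (h k)) (hm k.le_succ)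
  rw [hc]
  refine le_antisymm (hS.defectForm_nonpos (by norm_num) f) ?_
  -- A negative constant makes the first-order form increase linearly and become positive.
  by_contra! hneg
  obtain ⟨j, hj⟩ := exists_nat_gt (defectForm S 1 f / defectForm S 2 f)
  rw [div_lt_iff_of_neg hneg] at hj
  have h1 := defectForm_pow_apply hc j
  have h2 := hS.defectForm_nonpos le_rfl ((S ^ j) f)
  linarith

end DefectForm

/-! ### Orbits of `T` and the cycle of its graph. -/

section SelfMapGraph

variable {V : Type*} {T : V → V}

/-- An edge joins a point to its image, so the meeting of forward orbits persists along an
undirected path. -/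
lemma exists_iterate_eq_iterate_of_isConnected (h : (selfMapGraph T).IsConnected) (x y : V) :
    ∃ m n : ℕ, T^[m] x = T^[n] y := by
  have hr := h.preconnected x y
  rw [SimpleGraph.reachable_iff_reflTransGen] at hr
  induction hr with
  | refl => exact ⟨0, 0, rfl⟩
  | @tail b c _ hbc ih =>
    obtain ⟨m, n, hmn⟩ := ih
    have hadj : T c = b ∨ T b = c := by
      simpa [Digraph.toSimpleGraphInclusive, selfMapGraph] using hbc.2
    rcases hadj with hcb | hbc
    · exact ⟨m, n + 1, by rw [Function.iterate_succ_apply, hcb, hmn]⟩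
    · exact ⟨m + 1, n, by
        rw [Function.iterate_succ_apply', hmn, ← hbc, ← Function.iterate_succ_apply,
          Function.iterate_succ_apply']⟩

lemma exists_iterate_eq_of_isPeriodicPt (h : (selfMapGraph T).IsConnected) {x : V} {κ : ℕ}
    (hκ : 1 ≤ κ) (hx : Function.IsPeriodicPt T κ x) (y : V) : ∃ m : ℕ, T^[m] y = x := by
  obtain ⟨m, n, hmn⟩ := exists_iterate_eq_iterate_of_isConnected h y x
  -- After `T^[m] y = T^[n] x`, a further `κ * n - n` steps complete `n` full periods of `x`.
  refine ⟨(κ * n - n) + m, ?_⟩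
  rw [Function.iterate_add_apply, hmn, ← Function.iterate_add_apply,
    Nat.sub_add_cancel (Nat.le_mul_of_pos_left n hκ)]
  exact hx.mul_const n

lemma exists_isPeriodicPt_of_isCycleWithTrees (h : (selfMapGraph T).IsCycleWithTrees) :
    ∃ κ : ℕ, 1 ≤ κ ∧ ∃ x : V, Function.IsPeriodicPt T κ x := by
  obtain ⟨κ, hκ, v, -, hv, -⟩ := h
  refine ⟨κ, hκ, v ⟨0, hκ⟩, ?_⟩
  -- Edges run from `T x` to `x`, so `T` traverses the cycle backwards; `k = κ` gives periodicity.
  have hk : ∀ k : ℕ, T^[k] (v ⟨k % κ, Nat.mod_lt _ hκ⟩) = v ⟨0, hκ⟩ := fun k => by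
    induction k with
    | zero => simp
    | succ k ih =>
      rw [Function.iterate_succ_apply]
      have h1 := hv ⟨k % κ, Nat.mod_lt _ hκ⟩ ⟨(k + 1) % κ, Nat.mod_lt _ hκ⟩ (by simp)
      change T _ = _ at h1
      rw [h1, ih]
  simpa [Function.IsPeriodicPt, Function.IsFixedPt] using hk κ

end SelfMapGraph

/-! ### Functions with disjoint supports. -/

section DisjointSupports

variable {X : Type*}

/-- At every point one of the two functions vanishes. -/
def HasDisjointSupports (f g : ℓ²(X, ℂ)) : Prop := ∀ v, f v = 0 ∨ g v = 0

lemma HasDisjointSupports.inner_eq_zero {f g : ℓ²(X, ℂ)} (h : HasDisjointSupports f g) :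
    inner ℂ f g = 0 := by
  rw [lp.inner_eq_tsum]
  exact (tsum_congr fun v => by rcases h v with h | h <;> simp [h]).trans tsum_zero

lemma HasDisjointSupports.smul_left {f g : ℓ²(X, ℂ)} (h : HasDisjointSupports f g) (c : ℂ) :
    HasDisjointSupports (c • f) g := fun v =>
  (h v).imp_left fun h => by
    change c • f v = 0
    rw [h, smul_zero]

open Classical in
lemma exists_eq_smul_single_add (f : ℓ²(X, ℂ)) (x : X) :
    ∃ g : ℓ²(X, ℂ), f = f x • lp.single 2 x (1 : ℂ) + g ∧
      HasDisjointSupports (lp.single 2 x (1 : ℂ)) g := by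
  refine ⟨f - f x • lp.single 2 x (1 : ℂ), by abel, fun v => ?_⟩
  by_cases hv : v = x
  · subst hv
    right
    change f v - f v • lp.single (E := fun _ : X => ℂ) 2 v (1 : ℂ) v = 0
    rw [lp.single_apply_self]
    simp
  · exact Or.inl (lp.single_apply_ne _ _ _ hv)

end DisjointSupports

/-! ### Defect forms of the weighted shift. -/

section WeightedShift

lemma IsDiscreteMeasure.sqrt_ne_zero {X : Type*} [MeasurableSpace X]
    {μ : Measure X} (hμ : IsDiscreteMeasure μ) (x : X) :
    Real.sqrt (μ {x}).toReal ≠ 0 :=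
  (Real.sqrt_pos.2 (ENNReal.toReal_pos (hμ.pos x).ne' (hμ.lt_top x).ne)).ne'

variable {X : Type*} [MeasurableSpace X] [DiscreteMeasurableSpace X] [Countable X]
  {μ : Measure X} {hμ : IsDiscreteMeasure μ} {T : X → X} {hT : MemLp (selfMapDeriv μ T) ∞ μ}

/-- The product of the weights along an orbit telescopes. -/
lemma weightedShift_pow_apply (k : ℕ) (f : ℓ²(X, ℂ)) (v : X) :
    (weightedShift μ hμ T hT ^ k) f v =
      ((Real.sqrt (μ {v}).toReal / Real.sqrt (μ {T^[k] v}).toReal : ℝ) : ℂ) * f (T^[k] v) := by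
  induction k generalizing v with
  | zero => simp [hμ.sqrt_ne_zero v]
  | succ k ih =>
    rw [pow_succ', mul_apply_eq_comp, weightedShift_apply, ih, shiftWeight,
      Function.iterate_succ_apply, ← mul_assoc, ← Complex.ofReal_mul,
      div_mul_div_cancel₀ (hμ.sqrt_ne_zero _)]

lemma HasDisjointSupports.weightedShift_pow {f g : ℓ²(X, ℂ)} (h : HasDisjointSupports f g)
    (k : ℕ) : HasDisjointSupports ((weightedShift μ hμ T hT ^ k) f)
      ((weightedShift μ hμ T hT ^ k) g) := fun v => by
  rw [weightedShift_pow_apply, weightedShift_pow_apply]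
  exact (h (T^[k] v)).imp (fun h => by rw [h, mul_zero]) (fun h => by rw [h, mul_zero])

lemma HasDisjointSupports.defectForm_add {f g : ℓ²(X, ℂ)} (h : HasDisjointSupports f g) (n : ℕ) :
    defectForm (weightedShift μ hμ T hT) n (f + g) =
      defectForm (weightedShift μ hμ T hT) n f + defectForm (weightedShift μ hμ T hT) n g := by
  rw [defectForm, defectForm, defectForm, ← Finset.sum_add_distrib]
  refine Finset.sum_congr rfl fun k _ => ?_
  rw [map_add, ← mul_add, pow_two, pow_two, pow_two,
    norm_add_sq_eq_norm_sq_add_norm_sq_of_inner_eq_zero _ _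
      (h.weightedShift_pow k).inner_eq_zero]

lemma HasDisjointSupports.inner_defectOp_eq_zero {f g : ℓ²(X, ℂ)} (h : HasDisjointSupports f g)
    (n : ℕ) : inner ℂ f (defectOp (weightedShift μ hμ T hT) n g) = 0 := by
  rw [inner_defectOp]
  exact Finset.sum_eq_zero fun k _ => by rw [(h.weightedShift_pow k).inner_eq_zero, mul_zero]

open Classical in
-- Distinct basis vectors have disjoint supports, so the defect operator is diagonal and determined
-- by these values.
lemma isMIsometric_two_of_defectForm_single
    (h : ∀ x, defectForm (weightedShift μ hμ T hT) 2 (lp.single 2 x (1 : ℂ)) = 0) :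
    IsMIsometric 2 (weightedShift μ hμ T hT) := by
  rw [isMIsometric_two_iff]
  refine ContinuousLinearMap.ext fun f => lp.ext (funext fun x => ?_)
  obtain ⟨g, hfg, hg⟩ := exists_eq_smul_single_add f x
  have h1 : inner ℂ (lp.single 2 x (1 : ℂ)) (defectOp (weightedShift μ hμ T hT) 2 f) = 0 := by
    rw [hfg, map_add, map_smul, inner_add_right, inner_smul_right, inner_defectOp_self, h,
      hg.inner_defectOp_eq_zero]
    simp
  rw [lp.inner_single_left] at h1
  simpa using h1

open Classical in
lemma IsCompletelyHyperexpansive.defectForm_two_single_eq_zero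
    (hS : IsCompletelyHyperexpansive (weightedShift μ hμ T hT)) {x : X} {κ : ℕ} (hκ : 1 ≤ κ)
    (hx : Function.IsPeriodicPt T κ x) (k : ℕ) :
    defectForm (weightedShift μ hμ T hT) 2
      ((weightedShift μ hμ T hT ^ k) (lp.single 2 x (1 : ℂ))) = 0 := by
  refine hS.defectForm_two_eq_zero hκ (fun k => ?_) k
  obtain ⟨g, hfg, hg⟩ :=
    exists_eq_smul_single_add ((weightedShift μ hμ T hT ^ κ) (lp.single 2 x (1 : ℂ))) x
  -- The weights multiply to `1` over a period because `T^[κ] x = x`.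
  have h1 : (weightedShift μ hμ T hT ^ κ) (lp.single 2 x (1 : ℂ)) x = 1 := by
    rw [weightedShift_pow_apply, hx.eq, lp.single_apply_self, div_self (hμ.sqrt_ne_zero x)]
    simp
  rw [h1, one_smul] at hfg
  rw [pow_add, mul_apply_eq_comp, hfg, map_add,
    (hg.weightedShift_pow k).defectForm_add]
  linarith [hS.defectForm_nonpos (n := 2) (by norm_num) ((weightedShift μ hμ T hT ^ k) g)]

open Classical in
lemma IsCompletelyHyperexpansive.defectForm_two_single_eq_zero_of_iterate
    (hS : IsCompletelyHyperexpansive (weightedShift μ hμ T hT)) {x y : X} {m : ℕ}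
    (hy : T^[m] y = x)
    (h : defectForm (weightedShift μ hμ T hT) 2
      ((weightedShift μ hμ T hT ^ m) (lp.single 2 x (1 : ℂ))) = 0) :
    defectForm (weightedShift μ hμ T hT) 2 (lp.single 2 y (1 : ℂ)) = 0 := by
  obtain ⟨g, hfg, hg⟩ :=
    exists_eq_smul_single_add ((weightedShift μ hμ T hT ^ m) (lp.single 2 x (1 : ℂ))) y
  have hc : (weightedShift μ hμ T hT ^ m) (lp.single 2 x (1 : ℂ)) y ≠ 0 := by
    rw [weightedShift_pow_apply, hy, lp.single_apply_self, mul_one]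
    exact Complex.ofReal_ne_zero.2 (div_ne_zero (hμ.sqrt_ne_zero y) (hμ.sqrt_ne_zero x))
  -- Zero is now a positive multiple of the form at `e_y` plus its value at `g`, both nonpositive.
  rw [hfg, (hg.smul_left _).defectForm_add, defectForm_smul] at h
  have h1 := hS.defectForm_nonpos (n := 2) (by norm_num) g
  have h2 := hS.defectForm_nonpos (n := 2) (by norm_num) (lp.single 2 y (1 : ℂ))
  refine le_antisymm h2 (nonneg_of_mul_nonneg_right (a := ‖_‖ ^ 2) ?_
    (pow_pos (norm_pos_iff.2 hc) 2))
  linarith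

end WeightedShift

theorem mainTheorem3 {X : Type*} [Countable X] [MeasurableSpace X] [DiscreteMeasurableSpace X]
    (μ : Measure X) (hμ : IsDiscreteMeasure μ) (T : X → X)
    (hconn : (selfMapGraph T).IsConnected) (hcycle : (selfMapGraph T).IsCycleWithTrees)
    (hT : MemLp (selfMapDeriv μ T) ∞ μ) :
    IsMIsometric 2 (weightedShift μ hμ T hT) ↔
      IsCompletelyHyperexpansive (weightedShift μ hμ T hT) := by
  classical
  refine ⟨IsMIsometric.isCompletelyHyperexpansive, fun hS => ?_⟩
  obtain ⟨κ, hκ, x, hx⟩ := exists_isPeriodicPt_of_isCycleWithTrees hcycle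
  refine isMIsometric_two_of_defectForm_single fun y => ?_
  obtain ⟨m, hm⟩ := exists_iterate_eq_of_isPeriodicPt hconn hκ hx y
  refine hS.defectForm_two_single_eq_zero_of_iterate hm ?_
  convert hS.defectForm_two_single_eq_zero hκ hx m
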